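/- Let $T_\infty$ be the infinite rooted regular binary tree, i.e. the graph whose vertices are the words in two letters $x,y$, each word $w$ being joined to $xw$ and $yw$, with root the empty word. For $N\ge 0$ let $T_N$ be the finite subtree of words of length at most $N$. Let $\Omega_\infty=\operatorname{Aut}_{\mathrm{graph}}(T_\infty)$, with the profinite topology given by $\Omega_\infty\cong\varprojlim_N\Omega_N$, where $\Omega_N$ (a finite discrete group) is the image of the restriction map $\Omega_\infty\to\operatorname{Aut}_{\mathrm{graph}}(T_N)$. Let $H_1,H_2$ be two closed subgroups of $\Omega_\infty$, both of index at most $2$. Then $H_1$ and $H_2$ are isomorphic as topological groups if and only if $H_1=H_2$. -/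

import Mathlib

/-- The infinite rooted regular binary tree `T_∞`: the Cayley graph of the free monoid on two
letters, in which every word `w` is joined to `x w` for each letter `x`. The root is the empty
word `1`. -/
def binaryTree : SimpleGraph (FreeMonoid Bool) :=
  SimpleGraph.fromRel fun w v => ∃ s : Bool, v = FreeMonoid.of s * w

/-- The vertices of the finite subtree `T_N`: the words of length at most `N`. -/
def treeUpTo (N : ℕ) : Set (FreeMonoid Bool) :=
  {w | w.length ≤ N}

/-- The group `Ω_∞` of all graph automorphisms of `T_∞`, under composition. -/
abbrev Omega : Type := binaryTree ≃g binaryTree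

/-- Restriction of an automorphism of `T_∞` to the finite subtree `T_N`. Automorphisms preserve
`T_N`, so this determines, and is determined by, the image of `σ` in `Ω_N ≤ Aut(T_N)`. -/
def restrictToLevel (N : ℕ) (σ : Omega) : treeUpTo N → FreeMonoid Bool :=
  fun w => σ w

/-- The profinite topology of `Ω_∞ = lim Ω_N`: the coarsest topology for which every restriction
map `Ω_∞ → Ω_N` to a discrete target is continuous. -/
instance Omega.instTopologicalSpace : TopologicalSpace Omega :=
  ⨅ N : ℕ, TopologicalSpace.induced (restrictToLevel N) ⊥

/-! A topological isomorphism `φ : H₁ ≃ H₂` is studied through its effect on rigid stabilizers.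
Closed subgroups of index at most two are open and normal, so they contain all rigid stabilizers of
deep vertices. For `v` on level `n`, consider the vertices `w` below which the `φ`-image of `rist v
∩ H₁` moves something (`Meets`). Every deep `w` is met by exactly one `v`
(`exists_forall_existsUnique_meets`): two would give commuting images containing elements that act
below some vertex as non-commuting swaps, and if there were none, a preimage of `swap w` would
commute with all deep rigid stabilizers and so be trivial. Each deep level is thus partitioned by
the vertices of level `n`, and `H₂` permutes the parts as `H₁` permutes these vertices.

If `H₂` has the same orbits on pairs of vertices as `Omega`, the partition is `Omega`-invariant,
hence given by ancestors on level `n`. This yields a tree automorphism `f` with `φ` equal to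
conjugation by `f` (`exists_conj_of_pairTransitive`), and normality gives `H₁ = H₂`.

By symmetry it remains to treat two subgroups that are not pair-transitive. Both have index two and
contain `levelStab 2`, with quotient dihedral of order eight, so there are three candidates: the
stabilizer of level one, and the preimages of a Klein four-group and of a cyclic group, both
transitive on level two. The same partitions tell them apart (`swap_false_mem_of_mulEquiv`,
`swap_nil_mem_of_mulEquiv`). -/

/-! ### Automorphisms acting on words; ancestors are suffixes -/

theorem binaryTree_adj_iff (w v : List Bool) :
    binaryTree.Adj (FreeMonoid.ofList w) (FreeMonoid.ofList v) ↔
      (∃ s, v = s :: w) ∨ ∃ s, w = s :: v := by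
  have key : ∀ a b : List Bool,
      (∃ s : Bool, FreeMonoid.ofList b = FreeMonoid.of s * FreeMonoid.ofList a) ↔
        ∃ s, b = s :: a := fun a b => Iff.rfl
  unfold binaryTree
  rw [SimpleGraph.fromRel_adj, key, key]
  refine ⟨fun h => h.2, fun h => ⟨?_, h⟩⟩
  intro e
  have e' : w = v := e
  subst e'
  rcases h with ⟨s, h⟩ | ⟨s, h⟩ <;> simpa using congrArg List.length h

/-- Automorphisms of the binary tree act on its vertices, viewed as lists of letters. -/
instance Omega.listAction : MulAction Omega (List Bool) where
  smul g w := FreeMonoid.toList (g (FreeMonoid.ofList w))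
  one_smul _ := rfl
  mul_smul _ _ _ := rfl

namespace Omega

theorem ext_smul {g h : Omega} (H : ∀ w : List Bool, g • w = h • w) : g = h :=
  RelIso.ext H

theorem adj_smul (g : Omega) (w v : List Bool) :
    ((∃ s, g • v = s :: g • w) ∨ ∃ s, g • w = s :: g • v) ↔
      (∃ s, v = s :: w) ∨ ∃ s, w = s :: v := by
  rw [← binaryTree_adj_iff, ← binaryTree_adj_iff]
  exact g.map_rel_iff

-- The root has only two neighbours, whereas the three neighbours of a nonempty word would pull back
-- to three distinct one-letter words.
@[simp] theorem smul_nil (g : Omega) : g • ([] : List Bool) = [] := by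
  cases hw : g • ([] : List Bool) with
  | nil => rfl
  | cons s w =>
    exfalso
    have nb : ∀ u : List Bool, ((∃ t, u = t :: s :: w) ∨ ∃ t, s :: w = t :: u) →
        ∃ t, g⁻¹ • u = [t] := by
      intro u hu
      rw [← hw] at hu
      have h := (adj_smul g [] (g⁻¹ • u)).1 (by simpa only [smul_inv_smul] using hu)
      rcases h with h | ⟨t, h⟩
      · exact h
      · simp at h
    obtain ⟨a, ha⟩ := nb w (Or.inr ⟨s, rfl⟩)
    obtain ⟨b, hb⟩ := nb (true :: s :: w) (Or.inl ⟨true, rfl⟩)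
    obtain ⟨c, hc⟩ := nb (false :: s :: w) (Or.inl ⟨false, rfl⟩)
    have hab : a ≠ b := by
      rintro rfl
      have := congrArg List.length (smul_left_cancel g⁻¹ (ha.trans hb.symm))
      simp at this
      omega
    have hac : a ≠ c := by
      rintro rfl
      have := congrArg List.length (smul_left_cancel g⁻¹ (ha.trans hc.symm))
      simp at this
      omega
    have hbc : b ≠ c := by
      rintro rfl
      have := smul_left_cancel g⁻¹ (hb.trans hc.symm)
      simp at this
    revert hab hac hbc
    cases a <;> cases b <;> cases c <;> simp

/-- The parent of `g • w` is already the image of the parent of `w`, so injectivity leaves only its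
children. -/
theorem smul_cons (g : Omega) (s : Bool) (w : List Bool) : ∃ t, g • (s :: w) = t :: g • w := by
  induction w generalizing s with
  | nil =>
    rcases (adj_smul g [] [s]).2 (Or.inl ⟨s, rfl⟩) with h | ⟨t, h⟩
    · exact h
    · simp at h
  | cons s' w ih =>
    rcases (adj_smul g (s' :: w) (s :: s' :: w)).2 (Or.inl ⟨s, rfl⟩) with h | ⟨t, h⟩
    · exact h
    · obtain ⟨t', ht'⟩ := ih s'
      rw [ht'] at h
      have h2 := smul_left_cancel g (List.cons.inj h).2
      have := congrArg List.length h2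
      simp at this
      omega

@[simp] theorem length_smul (g : Omega) (w : List Bool) : (g • w).length = w.length := by
  induction w with
  | nil => simp
  | cons s w ih =>
    obtain ⟨t, ht⟩ := smul_cons g s w
    simp [ht, ih]

theorem smul_append (g : Omega) (u w : List Bool) :
    ∃ u', u'.length = u.length ∧ g • (u ++ w) = u' ++ g • w := by
  induction u with
  | nil => exact ⟨[], rfl, rfl⟩
  | cons s u ih =>
    obtain ⟨u', hu, h⟩ := ih
    obtain ⟨t, ht⟩ := smul_cons g s (u ++ w)
    exact ⟨t :: u', by simp [hu], by simp [ht, h]⟩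

theorem suffix_smul (g : Omega) {v w : List Bool} (h : v <:+ w) : g • v <:+ g • w := by
  obtain ⟨u, rfl⟩ := h
  obtain ⟨u', -, h⟩ := smul_append g u v
  exact ⟨u', h.symm⟩

theorem suffix_smul_iff (g : Omega) {v w : List Bool} : g • v <:+ g • w ↔ v <:+ w :=
  ⟨fun h => by simpa using suffix_smul g⁻¹ h, suffix_smul g⟩

theorem smul_eq_of_suffix {g : Omega} {v w : List Bool} (h : v <:+ w) (hw : g • w = w) :
    g • v = v := by
  have h1 := suffix_smul g h
  rw [hw] at h1
  exact (List.suffix_of_suffix_length_le h1 h (by simp)).eq_of_length (by simp)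

/-! ### Constructing automorphisms: swaps -/

/-- A permutation of the words that extends words by one letter is a tree automorphism. -/
def ofEquiv (e : List Bool ≃ List Bool) (h : ∀ s w, ∃ t, e (s :: w) = t :: e w) : Omega where
  toEquiv := (FreeMonoid.toList.trans e).trans FreeMonoid.ofList
  map_rel_iff' := by
    have hlen : ∀ w, (e w).length = w.length + (e []).length := by
      intro w
      induction w with
      | nil => simp
      | cons s w ih =>
        obtain ⟨t, ht⟩ := h s w
        simp [ht, ih]; omega
    have h0 : (e []).length = 0 := by
      have := hlen (e.symm [])
      rw [Equiv.apply_symm_apply, List.length_nil] at this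
      omega
    have key : ∀ a b : List Bool, (∃ s, e b = s :: e a) ↔ ∃ s, b = s :: a := by
      intro a b
      constructor
      · rintro ⟨s, hs⟩
        cases b with
        | nil => simp [hs] at h0
        | cons s' b =>
          obtain ⟨t, ht⟩ := h s' b
          rw [ht] at hs
          exact ⟨s', by rw [e.injective (List.cons.inj hs).2]⟩
      · rintro ⟨s, rfl⟩
        exact h s a
    intro a b
    refine (binaryTree_adj_iff (e a.toList) (e b.toList)).trans ?_
    rw [key, key]
    exact (binaryTree_adj_iff a.toList b.toList).symm

/-- The map on words underlying `swap`. -/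
def swapFun (x : List Bool) : List Bool → List Bool
  | [] => []
  | t :: w => if w = x then (!t) :: w else t :: swapFun x w

theorem swapFun_of_not_suffix {x w : List Bool} (h : ¬ x <:+ w) : swapFun x w = w := by
  induction w with
  | nil => rfl
  | cons t w ih =>
    have hw : ¬ x <:+ w := fun h' => h (h'.trans (List.suffix_cons t w))
    have hne : w ≠ x := by rintro rfl; exact hw (List.suffix_refl _)
    rw [swapFun, if_neg hne, ih hw]

theorem swapFun_self (x : List Bool) : swapFun x x = x := by
  cases x with
  | nil => rfl
  | cons t x =>
    rw [swapFun, if_neg (by simp), swapFun_of_not_suffix]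
    intro h
    simpa using h.length_le

theorem swapFun_swapFun (x w : List Bool) : swapFun x (swapFun x w) = w := by
  induction w with
  | nil => rfl
  | cons t w ih =>
    by_cases hw : w = x
    · subst hw; simp [swapFun]
    · have : swapFun x w ≠ x := by
        intro h
        rw [h, swapFun_self] at ih
        exact hw ih.symm
      simp [swapFun, hw, this, ih]

/-- The automorphism that interchanges the two subtrees hanging below the vertex `x`. -/
def swap (x : List Bool) : Omega :=
  ofEquiv ⟨swapFun x, swapFun x, swapFun_swapFun x, swapFun_swapFun x⟩ (by
    intro s w
    by_cases hw : w = x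
    · subst hw; exact ⟨!s, by simp [swapFun, swapFun_self]⟩
    · exact ⟨s, by simp [swapFun, hw]⟩)

theorem swap_smul (x w : List Bool) : swap x • w = swapFun x w := rfl

@[simp] theorem swap_smul_cons_self (x : List Bool) (t : Bool) :
    swap x • (t :: x) = (!t) :: x := by
  simp [swap_smul, swapFun]

theorem swap_mul_self (x : List Bool) : swap x * swap x = 1 :=
  ext_smul fun w => by simp [mul_smul, swap_smul, swapFun_swapFun]

/-! ### Rigid stabilizers -/

/-- The rigid stabilizer of a vertex `v`: the automorphisms supported on the subtree below `v`. -/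
def rist (v : List Bool) : Subgroup Omega where
  carrier := {g | ∀ w : List Bool, ¬ v <:+ w → g • w = w}
  one_mem' := fun _ _ => one_smul _ _
  mul_mem' := fun ha hb w hw => by rw [mul_smul, hb w hw, ha w hw]
  inv_mem' := fun ha w hw => by rw [inv_smul_eq_iff, ha w hw]

theorem swap_mem_rist (x : List Bool) : swap x ∈ rist x :=
  fun _ hw => swapFun_of_not_suffix hw

theorem rist_anti {v u : List Bool} (h : v <:+ u) : rist u ≤ rist v :=
  fun _ hg w hw => hg w fun h' => hw (h.trans h')

theorem suffix_smul_of_mem_rist {v w : List Bool} {g : Omega} (hg : g ∈ rist v) (h : v <:+ w) :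
    v <:+ g • w := by
  by_contra h'
  have h1 := smul_left_cancel g (hg _ h')
  rw [h1] at h'
  exact h' h

theorem smul_eq_of_mem_rist {v w : List Bool} {g : Omega} (hg : g ∈ rist v)
    (h : w.length ≤ v.length) : g • w = w := by
  by_cases hv : v <:+ w
  · have hvw := hv.eq_of_length_le h
    subst hvw
    exact ((suffix_smul_of_mem_rist hg hv).eq_of_length (by simp)).symm
  · exact hg w hv

theorem conj_mem_rist {v : List Bool} {g : Omega} (h : Omega) (hg : g ∈ rist v) :
    h * g * h⁻¹ ∈ rist (h • v) := by
  intro w hw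
  rw [mul_smul, mul_smul, hg, smul_inv_smul]
  intro h'
  exact hw (by simpa using suffix_smul h h')

theorem not_suffix_of_ne {v v' w : List Bool} (hl : v.length = v'.length) (hne : v ≠ v')
    (h : v <:+ w) : ¬ v' <:+ w := fun h' =>
  hne ((List.suffix_of_suffix_length_le h h' hl.le).eq_of_length hl)

theorem commute_of_mem_rist {v v' : List Bool} {g g' : Omega} (hl : v.length = v'.length)
    (hne : v ≠ v') (hg : g ∈ rist v) (hg' : g' ∈ rist v') : g * g' = g' * g := by
  refine ext_smul fun w => ?_
  rw [mul_smul, mul_smul]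
  by_cases h : v <:+ w
  · rw [hg' w (not_suffix_of_ne hl hne h),
      hg' _ (not_suffix_of_ne hl hne (suffix_smul_of_mem_rist hg h))]
  · rw [hg w h]
    by_cases h' : v' <:+ w
    · exact hg _ (not_suffix_of_ne hl.symm hne.symm (suffix_smul_of_mem_rist hg' h'))
    · rw [hg' w h', hg w h]

/-- The rigid stabilizer of `v` is transitive on each level below `v`. -/
theorem exists_mem_rist_smul_eq {v y y' : List Bool} (hl : y.length = y'.length)
    (h : v <:+ y) (h' : v <:+ y') : ∃ g ∈ rist v, g • y = y' := by
  obtain ⟨u, rfl⟩ := h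
  obtain ⟨u', rfl⟩ := h'
  simp only [List.length_append, Nat.add_right_cancel_iff] at hl
  induction u generalizing u' with
  | nil =>
    cases u' with
    | nil => exact ⟨1, one_mem _, one_smul _ _⟩
    | cons => simp at hl
  | cons s u ih =>
    cases u' with
    | nil => simp at hl
    | cons s' u' =>
      obtain ⟨g, hg, hgu⟩ := ih u' (by simpa using hl)
      obtain ⟨t, ht⟩ := smul_cons g s (u ++ v)
      rw [hgu] at ht
      by_cases hts : t = s'
      · exact ⟨g, hg, by rw [List.cons_append, ht, hts, List.cons_append]⟩
      · refine ⟨swap (u' ++ v) * g,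
          mul_mem (rist_anti (List.suffix_append u' v) (swap_mem_rist _)) hg, ?_⟩
        rw [mul_smul, List.cons_append, ht, swap_smul_cons_self, List.cons_append,
          ← Bool.eq_not_of_ne (Ne.symm hts)]

theorem exists_smul_eq {y y' : List Bool} (hl : y.length = y'.length) :
    ∃ g : Omega, g • y = y' :=
  let ⟨g, _, h⟩ := exists_mem_rist_smul_eq hl List.nil_suffix List.nil_suffix
  ⟨g, h⟩

/-- An automorphism that commutes with the rigid stabilizer of `v` fixes `v`. -/
theorem smul_eq_of_commute_rist {v : List Bool} {g : Omega}
    (h : ∀ r ∈ rist v, g * r = r * g) : g • v = v := by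
  have h1 := congrArg (· • (false :: v)) (h _ (swap_mem_rist v))
  simp only [mul_smul, swap_smul_cons_self, Bool.not_false] at h1
  -- By commutation `swap v` moves `g • (false :: v)`, and it moves nothing outside the subtree
  -- below `v`.
  have h2 : v <:+ g • (false :: v) := by
    by_contra hn
    rw [swap_mem_rist v _ hn] at h1
    simpa using smul_left_cancel g h1
  exact (List.suffix_of_suffix_length_le (suffix_smul g (List.suffix_cons false v)) h2
    (by simp)).eq_of_length (by simp)

/-! ### Level stabilizers and the topology -/

/-- The pointwise stabilizer of the finite subtree of words of length at most `n`. -/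
def levelStab (n : ℕ) : Subgroup Omega where
  carrier := {g | ∀ w : List Bool, w.length ≤ n → g • w = w}
  one_mem' := fun _ _ => one_smul _ _
  mul_mem' := fun ha hb w hw => by rw [mul_smul, hb w hw, ha w hw]
  inv_mem' := fun ha w hw => by rw [inv_smul_eq_iff, ha w hw]

theorem levelStab_anti {m n : ℕ} (h : m ≤ n) : levelStab n ≤ levelStab m :=
  fun _ hg w hw => hg w (hw.trans h)

theorem rist_le_levelStab {n : ℕ} {v : List Bool} (h : n ≤ v.length) : rist v ≤ levelStab n :=
  fun _ hg _ hw => smul_eq_of_mem_rist hg (hw.trans h)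

theorem exists_suffix_length_eq {n : ℕ} {w : List Bool} (h : n ≤ w.length) :
    ∃ v : List Bool, v.length = n ∧ v <:+ w :=
  ⟨w.drop (w.length - n), by simp; omega, List.drop_suffix _ _⟩

theorem exists_extension_length_eq {n : ℕ} {v : List Bool} (h : v.length ≤ n) :
    ∃ w : List Bool, w.length = n ∧ v <:+ w :=
  ⟨List.replicate (n - v.length) false ++ v, by simp; omega, List.suffix_append _ _⟩

theorem mem_levelStab_of_forall_length_eq {n : ℕ} {g : Omega}
    (h : ∀ w : List Bool, w.length = n → g • w = w) : g ∈ levelStab n := by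
  intro w hw
  obtain ⟨w', hw', hs⟩ := exists_extension_length_eq hw
  exact smul_eq_of_suffix hs (h w' hw')

open Topology in
theorem nhds_hasBasis (g : Omega) :
    (𝓝 g).HasBasis (fun _ : ℕ => True)
      fun N => {h | ∀ w : List Bool, w.length ≤ N → h • w = g • w} := by
  have hset : ∀ N : ℕ, {h : Omega | ∀ w : List Bool, w.length ≤ N → h • w = g • w} =
      restrictToLevel N ⁻¹' {restrictToLevel N g} := by
    intro N
    ext h
    simp only [Set.mem_ofPred_eq, Set.mem_preimage, Set.mem_singleton_iff, funext_iff]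
    exact ⟨fun H w => H _ w.2, fun H w hw => H ⟨w, hw⟩⟩
  have hn : 𝓝 g = ⨅ N : ℕ,
      Filter.principal {h | ∀ w : List Bool, w.length ≤ N → h • w = g • w} := by
    rw [show 𝓝 g = @nhds Omega (⨅ N : ℕ, TopologicalSpace.induced (restrictToLevel N) ⊥) g from rfl,
      nhds_iInf]
    refine iInf_congr fun N => ?_
    rw [hset]
    let : TopologicalSpace (treeUpTo N → FreeMonoid Bool) := ⊥
    have : DiscreteTopology (treeUpTo N → FreeMonoid Bool) := ⟨rfl⟩
    rw [nhds_induced, nhds_discrete, Filter.comap_pure]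
  rw [hn]
  refine Filter.hasBasis_iInf_principal ?_
  exact directed_of_isDirected_le fun i j hij h hh w hw => hh w (hw.trans hij)

theorem isOpen_levelStab (n : ℕ) : IsOpen (levelStab n : Set Omega) := by
  rw [isOpen_iff_mem_nhds]
  intro g hg
  refine (nhds_hasBasis g).mem_iff.2 ⟨n, trivial, fun h hh w hw => ?_⟩
  rw [hh w hw, hg w hw]

theorem exists_levelStab_subset {U : Set Omega} (hU : IsOpen U) (h1 : (1 : Omega) ∈ U) :
    ∃ n, (levelStab n : Set Omega) ⊆ U := by
  obtain ⟨n, -, hn⟩ := (nhds_hasBasis 1).mem_iff.1 (hU.mem_nhds h1)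
  exact ⟨n, fun g hg => hn fun w hw => by rw [hg w hw, one_smul]⟩

theorem continuous_mul_left (g : Omega) : Continuous fun h : Omega => g * h := by
  rw [continuous_iff_continuousAt]
  intro h
  refine ((nhds_hasBasis h).tendsto_iff (nhds_hasBasis (g * h))).2 fun N _ => ⟨N, trivial, ?_⟩
  intro x hx w hw
  rw [mul_smul, mul_smul, hx w hw]

theorem isOpen_of_isClosed_of_index {H : Subgroup Omega} (hH : IsClosed (H : Set Omega))
    (hi : H.index = 1 ∨ H.index = 2) : IsOpen (H : Set Omega) := by
  rcases hi with hi | hi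
  · rw [Subgroup.index_eq_one.1 hi]
    exact isOpen_univ
  · obtain ⟨g, hg⟩ : ∃ g, g ∉ H := by
      by_contra! h
      rw [(Subgroup.eq_top_iff' H).2 h] at hi
      simp at hi
    have : (H : Set Omega) = (fun h => g * h) ⁻¹' (H : Set Omega)ᶜ := by
      ext x
      simp [Subgroup.mul_mem_iff_of_index_two hi, hg]
    rw [this]
    exact hH.isOpen_compl.preimage (continuous_mul_left g)

theorem normal_of_index {H : Subgroup Omega} (hi : H.index = 1 ∨ H.index = 2) : H.Normal := by
  rcases hi with hi | hi
  · rw [Subgroup.index_eq_one.1 hi]; infer_instance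
  · exact Subgroup.normal_of_index_eq_two hi

theorem smul_ne_of_suffix {g : Omega} {z z' : List Bool} (h : z <:+ z') (hz : g • z ≠ z) :
    g • z' ≠ z' := fun h' => hz (smul_eq_of_suffix h h')

/-- The conjugate `g * r * g⁻¹` is supported below `g • x`, hence trivial below `x`, and only `r⁻¹`
survives. The bracketing shows the commutator as `g` times a conjugate of `g⁻¹`, the form in which
it is seen to lie in `imageRist`. -/
theorem commutator_smul {g r : Omega} {x y : List Bool} (hg : g • x ≠ x) (hr : r ∈ rist x)
    (h : x <:+ y) : (g * (r * g⁻¹ * r⁻¹)) • y = r⁻¹ • y := by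
  have h1 : g * (r * g⁻¹ * r⁻¹) = g * r * g⁻¹ * r⁻¹ := by group
  rw [h1, mul_smul]
  exact conj_mem_rist g hr _
    (not_suffix_of_ne (by simp) hg.symm (suffix_smul_of_mem_rist (inv_mem hr) h))

theorem commute_of_forall_suffix {g s : Omega} {w : List Bool} (hs : s ∈ rist w)
    (hg : ∀ z, w <:+ z → g • z = z) : s * g = g * s := by
  refine ext_smul fun z => ?_
  rw [mul_smul, mul_smul]
  by_cases hz : w <:+ z
  · rw [hg z hz, hg _ (suffix_smul_of_mem_rist hs hz)]
  · rw [hs z hz, hs]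
    intro h
    rw [← hg w (List.suffix_refl w), suffix_smul_iff] at h
    exact hz h

/-! ### Transporting rigid stabilizers through an isomorphism -/

variable {H₁ H₂ : Subgroup Omega} (φ : H₁ ≃* H₂)

/-- The image under `φ` of the rigid stabilizer of `v` in `H₁`. -/
def imageRist (v : List Bool) : Subgroup Omega :=
  ((rist v).comap H₁.subtype).map (H₂.subtype.comp φ.toMonoidHom)

variable {φ}

theorem mem_imageRist {v : List Bool} {g : Omega} :
    g ∈ imageRist φ v ↔ ∃ a : H₁, (a : Omega) ∈ rist v ∧ (φ a : Omega) = g := Iff.rfl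

theorem imageRist_anti {v v' : List Bool} (h : v <:+ v') : imageRist φ v' ≤ imageRist φ v := by
  rintro _ ⟨a, ha, rfl⟩
  exact ⟨a, rist_anti h ha, rfl⟩

theorem conj_mem_imageRist {v : List Bool} {g : Omega} (h : H₁) (hg : g ∈ imageRist φ v) :
    (φ h : Omega) * g * (φ h : Omega)⁻¹ ∈ imageRist φ ((h : Omega) • v) := by
  obtain ⟨a, ha, rfl⟩ := mem_imageRist.1 hg
  exact mem_imageRist.2 ⟨h * a * h⁻¹, conj_mem_rist (h : Omega) ha, by simp⟩

theorem commute_of_mem_imageRist {v v' : List Bool} {g g' : Omega} (hl : v.length = v'.length)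
    (hne : v ≠ v') (hg : g ∈ imageRist φ v) (hg' : g' ∈ imageRist φ v') : g * g' = g' * g := by
  obtain ⟨a, ha, rfl⟩ := mem_imageRist.1 hg
  obtain ⟨b, hb, rfl⟩ := mem_imageRist.1 hg'
  have : a * b = b * a := Subtype.ext (commute_of_mem_rist hl hne ha hb)
  rw [← Subgroup.coe_mul, ← map_mul, this, map_mul, Subgroup.coe_mul]

variable (φ)

/-- The image under `φ` of the rigid stabilizer of `v` moves some vertex below `w`. -/
def Meets (v w : List Bool) : Prop :=
  ∃ g ∈ imageRist φ v, ∃ z : List Bool, w <:+ z ∧ g • z ≠ z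

variable {φ}

theorem Meets.anti_left {v v' w : List Bool} (h : v <:+ v') (hm : Meets φ v' w) :
    Meets φ v w :=
  let ⟨g, hg, hz⟩ := hm
  ⟨g, imageRist_anti h hg, hz⟩

theorem Meets.anti_right {v w w' : List Bool} (h : w <:+ w') (hm : Meets φ v w') :
    Meets φ v w :=
  let ⟨g, hg, z, hz, hne⟩ := hm
  ⟨g, hg, z, h.trans hz, hne⟩

theorem Meets.smul {v w : List Bool} (hm : Meets φ v w) (h : H₁) :
    Meets φ ((h : Omega) • v) ((φ h : Omega) • w) := by
  obtain ⟨g, hg, z, hz, hne⟩ := hm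
  refine ⟨_, conj_mem_imageRist h hg, (φ h : Omega) • z, suffix_smul _ hz, ?_⟩
  rw [mul_smul, mul_smul, inv_smul_smul]
  exact fun h' => hne (smul_left_cancel _ h')

theorem exists_meets (h₁ : ∃ n, levelStab n ≤ H₁) (v : List Bool) (k : ℕ) :
    ∃ w : List Bool, w.length = k ∧ Meets φ v w := by
  obtain ⟨n, hn⟩ := h₁
  -- The vertex `x` is below `v` and deep enough for `swap x` to lie in `H₁`; by injectivity its
  -- image is nontrivial.
  obtain ⟨x, hx, hvx⟩ := exists_extension_length_eq (le_max_right n v.length)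
  have hs : swap x ∈ H₁ := hn (rist_le_levelStab (by omega) (swap_mem_rist x))
  obtain ⟨z, hz⟩ : ∃ z : List Bool, (φ ⟨swap x, hs⟩ : Omega) • z ≠ z := by
    by_contra! h
    have h1 : φ ⟨swap x, hs⟩ = 1 := Subtype.ext (ext_smul fun w => (h w).trans (one_smul _ _).symm)
    rw [map_eq_one_iff φ φ.injective] at h1
    have h2 := congrArg (· • (true :: x)) (congrArg Subtype.val h1)
    simp at h2
  obtain ⟨z', hz', hzz'⟩ := exists_extension_length_eq (le_max_right k z.length)
  obtain ⟨w, hw, hwz⟩ := exists_suffix_length_eq (n := k) (w := z') (by omega)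
  exact ⟨w, hw, _, mem_imageRist.2 ⟨_, rist_anti hvx (swap_mem_rist x), rfl⟩, z', hwz,
    smul_ne_of_suffix hzz' hz⟩

/-- The images for distinct `v`, `v'` commute. If both move vertices below `w`, then conjugation and
commutators with swaps produce an element of each, one acting below a vertex `x` as `swap x`, the
other as `swap (false :: x)`, and these do not commute. -/
theorem Meets.unique {n k : ℕ} (hk : ∀ g ∈ levelStab k, ∃ h : H₁, (h : Omega) ∈ levelStab n ∧
    (φ h : Omega) = g) {v v' w : List Bool} (hv : v.length = n) (hv' : v'.length = n)
    (hw : k ≤ w.length) (hm : Meets φ v w) (hm' : Meets φ v' w) : v = v' := by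
  by_contra hne
  have hconj : ∀ {r g : Omega} {u : List Bool}, u.length = n → r ∈ levelStab k →
      g ∈ imageRist φ u → r * g * r⁻¹ ∈ imageRist φ u := by
    intro r g u hu hr hg
    obtain ⟨h, hh, rfl⟩ := hk r hr
    have := conj_mem_imageRist h hg
    rwa [hh u hu.le] at this
  obtain ⟨a, ha, z, hz, haz⟩ := hm
  obtain ⟨b, hb, z', hz', hbz'⟩ := hm'
  obtain ⟨y, hy, hzy⟩ := exists_extension_length_eq (le_max_left z.length z'.length)
  obtain ⟨x, hx, hzx⟩ := exists_extension_length_eq (le_max_right z.length z'.length)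
  replace haz := smul_ne_of_suffix hzy haz
  replace hbz' := smul_ne_of_suffix hzx hbz'
  -- `r` is the image of an element fixing `v`, so conjugating `a` by it stays in `imageRist φ v`
  -- while making it move `x`, as `b` does.
  obtain ⟨r, hr, hry⟩ := exists_mem_rist_smul_eq (hy.trans hx.symm) (hz.trans hzy) (hz'.trans hzx)
  have ha' := hconj hv (rist_le_levelStab hw hr) ha
  have hax : (r * a * r⁻¹) • x ≠ x := by
    rw [← hry, mul_smul, mul_smul, inv_smul_smul]
    exact fun h => haz (smul_left_cancel _ h)
  generalize r * a * r⁻¹ = a' at ha' hax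
  have hkx : k ≤ x.length := hw.trans (hz'.trans hzx).length_le
  have hs := swap_mem_rist x
  have ht : swap (false :: x) ∈ rist x := rist_anti (List.suffix_cons _ _) (swap_mem_rist _)
  have hA := mul_mem ha' (hconj hv (rist_le_levelStab hkx hs) (inv_mem ha'))
  have hB := mul_mem hb (hconj hv' (rist_le_levelStab hkx ht) (inv_mem hb))
  have hc := commute_of_mem_imageRist (hv.trans hv'.symm) hne hA hB
  have hxy : x <:+ false :: false :: x := ⟨[false, false], rfl⟩
  have h1 := congrArg (· • (false :: false :: x)) hc
  simp only [mul_smul _ (b * _), mul_smul _ (a' * _)] at h1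
  rw [commutator_smul hbz' ht hxy, commutator_smul hax hs hxy,
    commutator_smul hbz' ht (suffix_smul_of_mem_rist (inv_mem hs) hxy),
    commutator_smul hax hs (suffix_smul_of_mem_rist (inv_mem ht) hxy),
    inv_eq_of_mul_eq_one_left (swap_mul_self x),
    inv_eq_of_mul_eq_one_left (swap_mul_self (false :: x))] at h1
  have h2 : ∀ t, swap x • (t :: false :: x) = t :: true :: x := by
    intro t
    simp [swap_smul, swapFun]
  rw [swap_smul_cons_self, h2, h2, swap_mem_rist (false :: x) (false :: true :: x)] at h1
  · simp at h1
  · exact not_suffix_of_ne (v := true :: x) (by simp) (by simp) ⟨[false], rfl⟩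

/-- Otherwise `swap w` commutes with the images of all rigid stabilizers of level at least `n`. Its
preimage then commutes with these stabilizers, so it fixes every vertex. -/
theorem exists_meets_of_length_eq {n k : ℕ} (hn : levelStab n ≤ H₁)
    (hk : ∀ g ∈ levelStab k, ∃ h : H₁, (φ h : Omega) = g) {w : List Bool} (hw : k ≤ w.length) :
    ∃ v : List Bool, v.length = n ∧ Meets φ v w := by
  by_contra! hno
  obtain ⟨h, hh⟩ := hk _ (rist_le_levelStab hw (swap_mem_rist w))
  have hfix : ∀ v : List Bool, n ≤ v.length → (h : Omega) • v = v := by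
    intro v hv
    refine smul_eq_of_commute_rist fun r hr => ?_
    have hrH : r ∈ H₁ := hn (rist_le_levelStab hv hr)
    obtain ⟨u, hu, huv⟩ := exists_suffix_length_eq hv
    have hc : (φ h : Omega) * (φ ⟨r, hrH⟩ : Omega) = (φ ⟨r, hrH⟩ : Omega) * (φ h : Omega) := by
      rw [hh]
      refine commute_of_forall_suffix (swap_mem_rist w) fun z hz => ?_
      by_contra hne
      exact hno u hu ⟨_, mem_imageRist.2 ⟨⟨r, hrH⟩, rist_anti huv hr, rfl⟩, z, hz, hne⟩
    have hc' : φ (h * ⟨r, hrH⟩) = φ (⟨r, hrH⟩ * h) := by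
      rw [map_mul, map_mul]
      exact Subtype.ext hc
    exact congrArg Subtype.val (φ.injective hc')
  have h1 : h = 1 := by
    refine Subtype.ext (ext_smul fun u => ?_)
    obtain ⟨x, hx, hux⟩ := exists_extension_length_eq (le_max_right n u.length)
    exact (smul_eq_of_suffix hux (hfix x (by omega))).trans (one_smul _ _).symm
  have h2 := congrArg (· • (true :: w)) hh
  simp [h1] at h2

theorem exists_levelStab_le {H : Subgroup Omega} (hH : IsOpen (H : Set Omega)) :
    ∃ n, levelStab n ≤ H :=
  exists_levelStab_subset hH H.one_mem

theorem exists_levelStab_le_image (hφ : Continuous φ.symm) (h₂ : IsOpen (H₂ : Set Omega)) (n : ℕ) :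
    ∃ k, ∀ g ∈ levelStab k, ∃ h : H₁, (h : Omega) ∈ levelStab n ∧ (φ h : Omega) = g := by
  have ho : IsOpen {x : H₂ | (φ.symm x : Omega) ∈ levelStab n} :=
    (isOpen_levelStab n).preimage (continuous_subtype_val.comp hφ)
  obtain ⟨k, hk⟩ := exists_levelStab_subset (h₂.isOpenMap_subtype_val _ ho)
    ⟨1, by simp [one_mem], rfl⟩
  refine ⟨k, fun g hg => ?_⟩
  obtain ⟨x, hx, rfl⟩ := hk hg
  exact ⟨φ.symm x, hx, by simp⟩

/-- For large `k`, each vertex `w` of level at least `k` lies in the support of the image of the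
rigid stabilizer of exactly one vertex of level `n`. -/
theorem exists_forall_existsUnique_meets (hφ : Continuous φ.symm) (h₁ : IsOpen (H₁ : Set Omega))
    (h₂ : IsOpen (H₂ : Set Omega)) (n : ℕ) :
    ∃ k, ∀ w : List Bool, k ≤ w.length → ∃! v : List Bool, v.length = n ∧ Meets φ v w := by
  obtain ⟨m, hm⟩ := exists_levelStab_le h₁
  -- Existence needs a level at least `m`, for rigid stabilizers inside `H₁`. The vertex found on
  -- level `max m n` is then replaced by its ancestor on level `n`.
  obtain ⟨k, hk⟩ := exists_levelStab_le_image hφ h₂ (max m n)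
  refine ⟨k, fun w hw => ?_⟩
  obtain ⟨v', hv', hvw⟩ := exists_meets_of_length_eq ((levelStab_anti (le_max_left m n)).trans hm)
    (fun g hg => let ⟨h, _, hh⟩ := hk g hg; ⟨h, hh⟩) hw
  obtain ⟨v, hv, hvv'⟩ := exists_suffix_length_eq (n := n) (w := v') (by omega)
  refine ⟨v, ⟨hv, hvw.anti_left hvv'⟩, fun u hu => ?_⟩
  refine Meets.unique (fun g hg => ?_) hu.1 hv hw hu.2 (hvw.anti_left hvv')
  obtain ⟨h, hh, rfl⟩ := hk g hg
  exact ⟨h, levelStab_anti (le_max_right m n) hh, rfl⟩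

/-! ### Invariant equivalence relations on a level -/

theorem suffix_iff_drop_eq {l k : ℕ} {p w : List Bool} (hp : p.length = l) (hw : w.length = k) :
    p <:+ w ↔ w.drop (k - l) = p := by
  subst hp hw
  exact List.suffix_iff_eq_drop.trans eq_comm

/-- An `Omega`-invariant equivalence relation on a level of the tree is the relation of having
the same ancestor on some fixed level. -/
theorem exists_level_of_invariant {k : ℕ} (r : List Bool → List Bool → Prop)
    (hrefl : ∀ w : List Bool, w.length = k → r w w)
    (hsymm : ∀ w w' : List Bool, w.length = k → w'.length = k → r w w' → r w' w)
    (htrans : ∀ w w' w'' : List Bool, w.length = k → w'.length = k → w''.length = k →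
      r w w' → r w' w'' → r w w'')
    (hinv : ∀ (g : Omega) (w w' : List Bool), w.length = k → w'.length = k → r w w' →
      r (g • w) (g • w')) :
    ∃ l ≤ k, ∀ w w' : List Bool, w.length = k → w'.length = k →
      (r w w' ↔ ∃ p : List Bool, p.length = l ∧ p <:+ w ∧ p <:+ w') := by
  classical
  -- The required level is the least `l` such that a common ancestor on level `l` forces
  -- equivalence.
  let P : ℕ → Prop := fun l => ∀ p w w' : List Bool, p.length = l → w.length = k →
    w'.length = k → p <:+ w → p <:+ w' → r w w'
  have hPk : P k := by
    intro p w w' hp hw hw' h h'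
    rw [← h.eq_of_length (by omega), ← h'.eq_of_length (by omega)]
    exact hrefl p hp
  have hex : ∃ l, P l := ⟨k, hPk⟩
  refine ⟨Nat.find hex, Nat.find_min' hex hPk, fun w w' hw hw' => ⟨fun hr => ?_, ?_⟩⟩
  swap
  · rintro ⟨p, hp, h, h'⟩
    exact Nat.find_spec hex p w w' hp hw hw' h h'
  by_contra hno
  -- the length of the longest common suffix
  let S : ℕ → Prop := fun j => ¬ ∃ p : List Bool, p.length = j ∧ p <:+ w ∧ p <:+ w'
  have hS : ∃ j, S j := ⟨_, hno⟩
  obtain ⟨j, hj⟩ : ∃ j, Nat.find hS = j + 1 := by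
    refine Nat.exists_eq_succ_of_ne_zero fun h0 => ?_
    have := Nat.find_spec hS
    rw [h0] at this
    exact this ⟨[], rfl, List.nil_suffix, List.nil_suffix⟩
  have hjl : j + 1 ≤ Nat.find hex := hj ▸ Nat.find_min' hS hno
  have hjS := Nat.find_spec hS
  rw [hj] at hjS
  obtain ⟨p, hp, hpw, hpw'⟩ := not_not.1 (Nat.find_min hS (show j < Nat.find hS by omega))
  have hlk : j < k := hjl.trans (Nat.find_min' hex hPk)
  have split : ∀ {q z : List Bool}, q.length = j → z.length = k → q <:+ z →
      ∃ t, (t :: q) <:+ z := by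
    rintro q z hq hz ⟨u, rfl⟩
    rcases List.eq_nil_or_concat u with rfl | ⟨u', t, rfl⟩
    · simp at hz; omega
    · exact ⟨t, u', by simp⟩
  refine Nat.find_min hex (show j < Nat.find hex by omega) ?_
  intro q z z' hq hz hz' hqz hqz'
  obtain ⟨g, hg⟩ := exists_smul_eq (hp.trans hq.symm)
  have hr' := hinv g w w' hw hw' hr
  have h1 := suffix_smul g hpw
  have h2 := suffix_smul g hpw'
  rw [hg] at h1 h2
  have hw1 : (g • w).length = k := by simp [hw]
  have hw2 : (g • w').length = k := by simp [hw']
  have hnc : ¬ ∃ t, (t :: q) <:+ g • w ∧ (t :: q) <:+ g • w' := by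
    rintro ⟨t, ht, ht'⟩
    refine hjS ⟨g⁻¹ • (t :: q), by simp [hq], ?_, ?_⟩
    · simpa using suffix_smul g⁻¹ ht
    · simpa using suffix_smul g⁻¹ ht'
  generalize g • w = x at *
  generalize g • w' = x' at *
  obtain ⟨t, ht⟩ := split hq hw1 h1
  obtain ⟨t', ht'⟩ := split hq hw2 h2
  have htt' : t ≠ t' := by
    rintro rfl
    exact hnc ⟨t, ht, ht'⟩
  -- The rigid stabilizers of the two children of `q` move the two sides independently, so one
  -- related pair across the fork makes all such pairs related. Transitivity then gives `P j`,
  -- against minimality.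
  have hcross : ∀ y y' : List Bool, y.length = k → y'.length = k → (t :: q) <:+ y →
      (t' :: q) <:+ y' → r y y' := by
    intro y y' hy hy' h h'
    obtain ⟨a, ha, hay⟩ := exists_mem_rist_smul_eq (hw1.trans hy.symm) ht h
    obtain ⟨b, hb, hby⟩ := exists_mem_rist_smul_eq (hw2.trans hy'.symm) ht' h'
    have e1 := hinv a _ _ hw1 hw2 hr'
    rw [hay, ha x' (not_suffix_of_ne (by simp) (by simp [htt'.symm]) ht')] at e1
    have e2 := hinv b _ _ hy hw2 e1
    rwa [hby, hb y (not_suffix_of_ne (by simp) (by simp [htt']) h)] at e2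
  obtain ⟨s, hs⟩ := split hq hz hqz
  obtain ⟨s', hs'⟩ := split hq hz' hqz'
  have hbool : ∀ b, b = t ∨ b = t' := by
    intro b
    revert htt'
    cases b <;> cases t <;> cases t' <;> simp
  rcases hbool s with rfl | rfl <;> rcases hbool s' with rfl | rfl
  · exact htrans _ _ _ hz hw2 hz' (hcross _ _ hz hw2 hs ht')
      (hsymm _ _ hz' hw2 (hcross _ _ hz' hw2 hs' ht'))
  · exact hcross _ _ hz hz' hs hs'
  · exact hsymm _ _ hz' hz (hcross _ _ hz' hz hs' hs)
  · exact htrans _ _ _ hz hw1 hz' (hsymm _ _ hw1 hz (hcross _ _ hw1 hz ht hs))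
      (hcross _ _ hw1 hz' ht hs')

/-! ### The pair-transitive case -/

/-- `H` has the same orbits as `Omega` on pairs of vertices. -/
def PairTransitive (H : Subgroup Omega) : Prop :=
  ∀ (x y : List Bool) (g : Omega), ∃ h ∈ H, h • x = g • x ∧ h • y = g • y

theorem le_of_injOn {m n : ℕ} (f : List Bool → List Bool)
    (hf : ∀ v, v.length = m → (f v).length = n)
    (hinj : ∀ v v', v.length = m → v'.length = m → f v = f v' → v = v') : m ≤ n := by
  have h := Fintype.card_le_of_injective
    (α := List.Vector Bool m) (β := List.Vector Bool n) (fun v => ⟨f v.1, hf v.1 v.2⟩)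
    (fun v v' h => Subtype.ext (hinj _ _ v.2 v'.2 (congrArg Subtype.val h)))
  rw [card_vector, card_vector, Fintype.card_bool] at h
  exact (Nat.pow_le_pow_iff_right (by norm_num)).1 h

/-- Being met by the same `v` is an equivalence relation on level `k`, so it amounts to a common
ancestor on some level `l`. Counting classes, `2 ^ l = 2 ^ n`, gives `l = n`. -/
theorem exists_forall_meets_iff (hφ : Continuous φ.symm) (h₁ : IsOpen (H₁ : Set Omega))
    (h₂ : IsOpen (H₂ : Set Omega)) (hQ : PairTransitive H₂) (n : ℕ) :
    ∃ k, ∀ v : List Bool, v.length = n → ∃ p : List Bool, p.length = n ∧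
      ∀ w : List Bool, k ≤ w.length → (Meets φ v w ↔ p <:+ w) := by
  obtain ⟨k, hk⟩ := exists_forall_existsUnique_meets hφ h₁ h₂ n
  have hl₁ := exists_levelStab_le h₁
  let r : List Bool → List Bool → Prop := fun w w' =>
    ∃ v : List Bool, v.length = n ∧ Meets φ v w ∧ Meets φ v w'
  have huniq : ∀ {v v' w : List Bool}, k ≤ w.length → v.length = n → v'.length = n →
      Meets φ v w → Meets φ v' w → v = v' := fun hw hv hv' h h' =>
    (hk _ hw).unique ⟨hv, h⟩ ⟨hv', h'⟩
  obtain ⟨l, hlk, hl⟩ := exists_level_of_invariant (k := k) r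
    (fun w hw => let ⟨v, hv, _⟩ := hk w hw.ge; ⟨v, hv.1, hv.2, hv.2⟩)
    (fun w w' _ _ ⟨v, hv, h, h'⟩ => ⟨v, hv, h', h⟩)
    (fun w w' w'' _ hw' _ ⟨v, hv, h, h'⟩ ⟨u, hu, g, g'⟩ => by
      have := huniq hw'.ge hv hu h' g
      subst this
      exact ⟨v, hv, h, g'⟩)
    (fun g w w' _ _ ⟨v, hv, h, h'⟩ => by
      -- Invariance concerns only two vertices at a time, so an element of `H₂` agreeing with `g` on
      -- this pair suffices.
      obtain ⟨x, hx, e, e'⟩ := hQ w w' g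
      obtain ⟨y, hy⟩ := φ.surjective ⟨x, hx⟩
      have hy' : (φ y : Omega) = x := congrArg Subtype.val hy
      rw [← e, ← e', ← hy']
      exact ⟨(y : Omega) • v, by simp [hv], h.smul y, h'.smul y⟩)
  choose c hck hc using fun v => exists_meets (φ := φ) hl₁ v k
  have hln : l = n := by
    refine le_antisymm ?_ ?_
    · have h1 : ∀ p : List Bool, p.length = l → ∃ v : List Bool, v.length = n ∧
          ∃ w : List Bool, w.length = k ∧ p <:+ w ∧ Meets φ v w := by
        intro p hp
        obtain ⟨w, hw, hpw⟩ := exists_extension_length_eq (hp.trans_le hlk)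
        obtain ⟨v, hv, -⟩ := hk w hw.ge
        exact ⟨v, hv.1, w, hw, hpw, hv.2⟩
      choose! f hf F hF using h1
      refine le_of_injOn f hf fun p p' hp hp' h => ?_
      obtain ⟨a1, a2, a3⟩ := hF p hp
      obtain ⟨b1, b2, b3⟩ := hF p' hp'
      obtain ⟨q, hq, hqw, hqw'⟩ := (hl _ _ a1 b1).1 ⟨f p, hf p hp, a3, h ▸ b3⟩
      rw [suffix_iff_drop_eq hp a1] at a2
      rw [suffix_iff_drop_eq hp' b1] at b2
      rw [suffix_iff_drop_eq hq a1] at hqw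
      rw [suffix_iff_drop_eq hq b1] at hqw'
      rw [← a2, hqw, ← hqw', b2]
    · refine le_of_injOn (fun v => (c v).drop (k - l)) (fun v _ => by simp [hck]; omega)
        fun v v' hv hv' h => ?_
      obtain ⟨u, hu, h1, h2⟩ := (hl _ _ (hck v) (hck v')).2
        ⟨(c v).drop (k - l), by simp [hck]; omega, List.drop_suffix _ _,
          by rw [h]; exact List.drop_suffix _ _⟩
      rw [huniq (hck v).ge hv hu (hc v) h1, huniq (hck v').ge hv' hu (hc v') h2]
  subst hln
  refine ⟨k, fun v hv => ?_⟩
  obtain ⟨p, hp, hpc⟩ := exists_suffix_length_eq (hlk.trans_eq (hck v).symm)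
  have hlevel : ∀ w : List Bool, w.length = k → (Meets φ v w ↔ p <:+ w) := by
    intro w hw
    constructor
    · intro hm
      obtain ⟨q, hq, hqc, hqw⟩ := (hl _ _ (hck v) hw).1 ⟨v, hv, hc v, hm⟩
      rw [suffix_iff_drop_eq hq (hck v)] at hqc
      rw [suffix_iff_drop_eq hp (hck v)] at hpc
      rwa [← hpc, hqc]
    · intro hpw
      obtain ⟨u, hu, hm, hm'⟩ := (hl _ _ (hck v) hw).2 ⟨p, hp, hpc, hpw⟩
      rwa [huniq (hck v).ge hv hu (hc v) hm]
  refine ⟨p, hp, fun w hw => ?_⟩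
  obtain ⟨w', hw', hs⟩ := exists_suffix_length_eq hw
  constructor
  · exact fun hm => ((hlevel w' hw').1 (hm.anti_right hs)).trans hs
  · intro hpw
    obtain ⟨u, hu, -⟩ := hk w hw
    have hpw' := List.suffix_of_suffix_length_le hpw hs (by omega)
    rw [huniq hw'.ge hv hu.1 ((hlevel w' hw').2 hpw') (hu.2.anti_right hs)]
    exact hu.2

/-- An isomorphism onto an open pair-transitive subgroup is conjugation by a tree automorphism. -/
theorem exists_conj_of_pairTransitive (hφ : Continuous φ.symm) (h₁ : IsOpen (H₁ : Set Omega))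
    (h₂ : IsOpen (H₂ : Set Omega)) (hQ : PairTransitive H₂) :
    ∃ f : Omega, ∀ h : H₁, (φ h : Omega) = f * h * f⁻¹ := by
  have hl₁ := exists_levelStab_le h₁
  choose K hK using exists_forall_meets_iff hφ h₁ h₂ hQ
  choose K' hK' using exists_forall_existsUnique_meets hφ h₁ h₂
  have hex : ∀ v : List Bool, ∃ p : List Bool, p.length = v.length ∧
      ∀ w : List Bool, K v.length ≤ w.length → (Meets φ v w ↔ p <:+ w) :=
    fun v => hK v.length v rfl
  choose F hFl hF using hex
  have heq : ∀ {p q w : List Bool}, p.length = q.length → p <:+ w → q <:+ w → p = q :=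
    fun hl hp hq => (List.suffix_of_suffix_length_le hp hq hl.le).eq_of_length hl
  have hinj : Function.Injective F := by
    intro v v' h
    have hv : v.length = v'.length := by rw [← hFl, h, hFl]
    obtain ⟨w, hw, hm⟩ := exists_meets (φ := φ) hl₁ v (max (K v.length) (K' v.length))
    have hm' : Meets φ v' w := by
      rw [hF v' w (by rw [← hv]; omega), ← h, ← hF v w (by omega)]
      exact hm
    exact (hK' v.length w (by omega)).unique ⟨rfl, hm⟩ ⟨hv.symm, hm'⟩
  have hsurj : Function.Surjective F := by
    intro p
    obtain ⟨w, hw, hpw⟩ := exists_extension_length_eq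
      (le_max_left p.length (max (K p.length) (K' p.length)))
    obtain ⟨v, ⟨hv, hm⟩, -⟩ := hK' p.length w (by omega)
    refine ⟨v, heq (by rw [hFl, hv]) ((hF v w ?_).1 hm) hpw⟩
    rw [hv]; omega
  have hcons : ∀ s v, ∃ t, F (s :: v) = t :: F v := by
    intro s v
    obtain ⟨w, hw, hm⟩ := exists_meets (φ := φ) hl₁ (s :: v)
      (max (K (s :: v).length) (K v.length))
    have h1 := (hF (s :: v) w (by omega)).1 hm
    have h2 := (hF v w (by omega)).1 (hm.anti_left (List.suffix_cons s v))
    have hlen : (F (s :: v)).length = v.length + 1 := hFl _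
    obtain ⟨t, q, htq⟩ := List.exists_cons_of_length_eq_add_one hlen
    refine ⟨t, ?_⟩
    rw [htq] at h1 hlen ⊢
    rw [heq (p := q) (q := F v) (by rw [hFl]; simpa using hlen)
      ((List.suffix_cons t q).trans h1) h2]
  refine ⟨ofEquiv (Equiv.ofBijective F ⟨hinj, hsurj⟩) hcons, fun h => ?_⟩
  rw [eq_mul_inv_iff_mul_eq]
  refine ext_smul fun v => ?_
  rw [mul_smul, mul_smul]
  change (φ h : Omega) • F v = F ((h : Omega) • v)
  obtain ⟨w, hw, hm⟩ := exists_meets (φ := φ) hl₁ v (K v.length)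
  have h1 := suffix_smul (φ h : Omega) ((hF v w hw.ge).1 hm)
  have h2 := (hF ((h : Omega) • v) ((φ h : Omega) • w) (by simp [hw])).1 (hm.smul h)
  -- Both sides are ancestors of `φ h • w` on the same level.
  exact heq (by simp [hFl]) h1 h2

theorem eq_of_pairTransitive (hφ : Continuous φ.symm) (h₁ : IsOpen (H₁ : Set Omega))
    (h₂ : IsOpen (H₂ : Set Omega)) (hQ : PairTransitive H₂) [hn : H₁.Normal] : H₁ = H₂ := by
  obtain ⟨f, hf⟩ := exists_conj_of_pairTransitive hφ h₁ h₂ hQ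
  ext g
  constructor
  · intro hg
    have h1 := hf ⟨f⁻¹ * g * f, by simpa using hn.conj_mem g hg f⁻¹⟩
    have h2 : (φ ⟨f⁻¹ * g * f, by simpa using hn.conj_mem g hg f⁻¹⟩ : Omega) = g := by
      rw [h1]; group
    rw [← h2]
    exact SetLike.coe_mem _
  · intro hg
    have h1 := hf (φ.symm ⟨g, hg⟩)
    rw [MulEquiv.apply_symm_apply] at h1
    change g = _ at h1
    rw [h1]
    exact hn.conj_mem _ (SetLike.coe_mem _) f

/-! ### Subgroups of index two that are not pair-transitive -/

/-- The automorphism that agrees with `g` below its fixed vertex `z` and is trivial elsewhere. -/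
def restrictBelow (g : Omega) (z : List Bool) (hz : g • z = z) : Omega :=
  have hz' : ∀ w, z <:+ w → z <:+ g • w := fun w h => by simpa [hz] using suffix_smul g h
  have hz'' : ∀ w, z <:+ w → z <:+ g⁻¹ • w := fun w h => by
    simpa [inv_smul_eq_iff.2 hz.symm] using suffix_smul g⁻¹ h
  ofEquiv
    { toFun := fun w => if z <:+ w then g • w else w
      invFun := fun w => if z <:+ w then g⁻¹ • w else w
      left_inv := fun w => by
        by_cases h : z <:+ w
        · simp [h, hz' w h]
        · simp [h]
      right_inv := fun w => by
        by_cases h : z <:+ w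
        · simp [h, hz'' w h]
        · simp [h] }
    (fun s w => by
      by_cases h : z <:+ w
      · simpa [h, h.trans (List.suffix_cons s w)] using smul_cons g s w
      · by_cases h' : z <:+ s :: w
        · have hzw : z = s :: w := (List.suffix_cons_iff.1 h').resolve_right h
          exact ⟨s, by simp [h, ← hzw, hz]⟩
        · exact ⟨s, by simp [h, h']⟩)

theorem restrictBelow_smul (g : Omega) (z : List Bool) (hz : g • z = z) (w : List Bool) :
    restrictBelow g z hz • w = if z <:+ w then g • w else w := rfl

theorem restrictBelow_mem_rist (g : Omega) (z : List Bool) (hz : g • z = z) :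
    restrictBelow g z hz ∈ rist z := fun w hw => by simp [restrictBelow_smul, hw]

/-- An element fixing level two is the product of its restrictions to the four subtrees hanging
there. -/
theorem levelStab_two_le_of_rist_le {H : Subgroup Omega}
    (hH : ∀ z : List Bool, z.length = 2 → rist z ≤ H) : levelStab 2 ≤ H := by
  intro g hg
  let R : ∀ c d : Bool, Omega := fun c d => restrictBelow g [c, d] (hg _ le_rfl)
  have hR : ∀ c d, R c d ∈ H := fun c d => hH [c, d] rfl (restrictBelow_mem_rist _ _ _)
  suffices h : g = R false false * R false true * R true false * R true true by
    rw [h]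
    exact mul_mem (mul_mem (mul_mem (hR _ _) (hR _ _)) (hR _ _)) (hR _ _)
  refine ext_smul fun w => ?_
  by_cases hw : w.length ≤ 2
  · have : ∀ c d, R c d • w = w := fun c d =>
      smul_eq_of_mem_rist (restrictBelow_mem_rist _ _ _) hw
    simp only [mul_smul, this, hg w hw]
  · obtain ⟨z, hz, hzw⟩ := exists_suffix_length_eq (n := 2) (w := w) (by omega)
    have hzg : z <:+ g • w := by simpa [hg z hz.le] using suffix_smul g hzw
    have h1 : ∀ c d, z = [c, d] → R c d • w = g • w := by
      rintro c d rfl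
      simp [R, restrictBelow_smul, hzw]
    have h2 : ∀ c d, z ≠ [c, d] → R c d • w = w ∧ R c d • g • w = g • w := by
      intro c d hne
      exact ⟨restrictBelow_mem_rist _ _ _ _ (not_suffix_of_ne (by simp [hz]) hne hzw),
        restrictBelow_mem_rist _ _ _ _ (not_suffix_of_ne (by simp [hz]) hne hzg)⟩
    obtain ⟨c, d, rfl⟩ := List.length_eq_two.1 hz
    simp only [mul_smul]
    cases c <;> cases d <;> simp [h1, h2]

variable {H : Subgroup Omega}

/-- For a pair `x`, `y` witnessing the failure, any `t` fixing both lies in `H`, since otherwise `g`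
or `g * t` would be the missing element. Two vertices have at most two of the four level-two
vertices as ancestors, so some `rist z` fixes both, and normality spreads this over level two. -/
theorem levelStab_two_le_of_not_pairTransitive (hi : H.index = 2) (hH : ¬ PairTransitive H) :
    levelStab 2 ≤ H := by
  have hn : H.Normal := Subgroup.normal_of_index_eq_two hi
  unfold PairTransitive at hH
  push Not at hH
  obtain ⟨x, y, g, hg⟩ := hH
  have hst : ∀ t : Omega, t • x = x → t • y = y → t ∈ H := by
    intro t hx hy
    by_contra ht
    have hgH : g ∉ H := fun h => hg g h rfl rfl
    refine hg (g * t) ((Subgroup.mul_mem_iff_of_index_two hi).2 (by tauto)) ?_ ?_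
    · rw [mul_smul, hx]
    · rw [mul_smul, hy]
  obtain ⟨z, hz, hzx, hzy⟩ : ∃ z : List Bool, z.length = 2 ∧ ¬ z <:+ x ∧ ¬ z <:+ y := by
    by_contra! hno
    have h1 := hno [false, false] rfl
    have h2 := hno [false, true] rfl
    have h3 := hno [true, false] rfl
    have d1 := fun u => not_suffix_of_ne (v := [false, false]) (v' := [false, true]) (w := u)
      rfl (by simp)
    have d2 := fun u => not_suffix_of_ne (v := [false, false]) (v' := [true, false]) (w := u)
      rfl (by simp)
    have d3 := fun u => not_suffix_of_ne (v := [false, true]) (v' := [true, false]) (w := u)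
      rfl (by simp)
    have d1x := d1 x
    have d1y := d1 y
    have d2x := d2 x
    have d2y := d2 y
    have d3x := d3 x
    have d3y := d3 y
    tauto
  refine levelStab_two_le_of_rist_le fun z' hz' r hr => ?_
  obtain ⟨k, hk⟩ := exists_smul_eq (hz.trans hz'.symm)
  have h1 := conj_mem_rist k⁻¹ hr
  rw [← hk, inv_smul_smul] at h1
  simpa [mul_assoc] using hn.conj_mem _ (hst _ (h1 x hzx) (h1 y hzy)) k

theorem exists_swap_mul_smul_cons {g : Omega} {x : List Bool} (hg : g • x = x) :
    ∃ e : Omega, (e = 1 ∨ e = swap x) ∧ ∀ t, (e * g) • (t :: x) = t :: x := by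
  obtain ⟨c, hc⟩ := smul_cons g false x
  obtain ⟨d, hd⟩ := smul_cons g true x
  rw [hg] at hc hd
  have hcd : c ≠ d := by
    rintro rfl
    simpa using smul_left_cancel g (hc.trans hd.symm)
  cases c with
  | false =>
    obtain rfl : d = true := by simpa using hcd.symm
    refine ⟨1, Or.inl rfl, fun t => ?_⟩
    cases t <;> simp [hc, hd]
  | true =>
    obtain rfl : d = false := by simpa using hcd.symm
    refine ⟨swap x, Or.inr rfl, fun t => ?_⟩
    cases t <;> simp [mul_smul, hc, hd]

/-! ### Index-two subgroups of the dihedral quotient -/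

/-- Modulo the stabilizer of level two, every automorphism is a product of swaps. -/
theorem exists_swaps_mul_mem_levelStab (g : Omega) :
    ∃ r p q : Omega, (r = 1 ∨ r = swap []) ∧ (p = 1 ∨ p = swap [false]) ∧
      (q = 1 ∨ q = swap [true]) ∧ q * (p * (r * g)) ∈ levelStab 2 := by
  obtain ⟨r, hr, hrg⟩ := exists_swap_mul_smul_cons (smul_nil g)
  obtain ⟨p, hp, hpg⟩ := exists_swap_mul_smul_cons (hrg false)
  have hpR : p ∈ rist [false] := by
    rcases hp with rfl | rfl
    · exact one_mem _
    · exact swap_mem_rist _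
  have hpt : (p * (r * g)) • [true] = [true] := by
    rw [mul_smul, hrg true, smul_eq_of_mem_rist hpR (by simp)]
  obtain ⟨q, hq, hqg⟩ := exists_swap_mul_smul_cons hpt
  have hqR : q ∈ rist [true] := by
    rcases hq with rfl | rfl
    · exact one_mem _
    · exact swap_mem_rist _
  refine ⟨r, p, q, hr, hp, hq, mem_levelStab_of_forall_length_eq fun w hw => ?_⟩
  obtain ⟨c, d, rfl⟩ := List.length_eq_two.1 hw
  cases d with
  | true => exact hqg c
  | false =>
    rw [mul_smul, hpg c]
    exact hqR _ (not_suffix_of_ne (v := [false]) rfl (by simp) ⟨[c], rfl⟩)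

/-- Modulo `levelStab 2`, the two swaps are conjugate under `swap []`. -/
theorem swap_true_mem_iff (hi : H.index = 2) (h2 : levelStab 2 ≤ H) :
    swap [true] ∈ H ↔ swap [false] ∈ H := by
  have h : swap [] * (swap [true] * (swap [] * swap [false])) ∈ levelStab 2 := by
    refine mem_levelStab_of_forall_length_eq fun w hw => ?_
    obtain ⟨c, d, rfl⟩ := List.length_eq_two.1 hw
    cases c <;> cases d <;> rfl
  replace h := h2 h
  simp only [Subgroup.mul_mem_iff_of_index_two hi] at h
  tauto

theorem swap_nil_notMem (hi : H.index = 2) (h2 : levelStab 2 ≤ H) (ha : swap [false] ∈ H) :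
    swap [] ∉ H := by
  intro hs
  have hb := (swap_true_mem_iff hi h2).2 ha
  have : H = ⊤ := by
    refine (Subgroup.eq_top_iff' H).2 fun g => ?_
    obtain ⟨r, p, q, hr, hp, hq, hg⟩ := exists_swaps_mul_mem_levelStab g
    replace hg := h2 hg
    rcases hr with rfl | rfl <;> rcases hp with rfl | rfl <;> rcases hq with rfl | rfl <;>
      simpa [Subgroup.mul_mem_cancel_left, hs, ha, hb] using hg
  simp [this] at hi

/-- A subgroup of index two is the kernel of a sign character, here determined by its values on the
three swaps, two of which agree. -/
theorem eq_of_swap_mem_iff {H₁ H₂ : Subgroup Omega} (hi₁ : H₁.index = 2) (hi₂ : H₂.index = 2)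
    (h₁ : levelStab 2 ≤ H₁) (h₂ : levelStab 2 ≤ H₂) (hs : swap [] ∈ H₁ ↔ swap [] ∈ H₂)
    (ha : swap [false] ∈ H₁ ↔ swap [false] ∈ H₂) : H₁ = H₂ := by
  have hb : swap [true] ∈ H₁ ↔ swap [true] ∈ H₂ := by
    rw [swap_true_mem_iff hi₁ h₁, swap_true_mem_iff hi₂ h₂, ha]
  ext g
  obtain ⟨r, p, q, hr, hp, hq, hg⟩ := exists_swaps_mul_mem_levelStab g
  have g₁ := h₁ hg
  have g₂ := h₂ hg
  simp only [Subgroup.mul_mem_iff_of_index_two hi₁] at g₁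
  simp only [Subgroup.mul_mem_iff_of_index_two hi₂] at g₂
  have hr' : r ∈ H₁ ↔ r ∈ H₂ := by rcases hr with rfl | rfl <;> simp [one_mem, hs]
  have hp' : p ∈ H₁ ↔ p ∈ H₂ := by rcases hp with rfl | rfl <;> simp [one_mem, ha]
  have hq' : q ∈ H₁ ↔ q ∈ H₂ := by rcases hq with rfl | rfl <;> simp [one_mem, hb]
  rw [hr', hp', hq'] at g₁
  clear hr hp hq hr' hp' hq' hg hs ha hb
  grind

/-- A subgroup of index two without the swaps at level one is transitive on every level. -/
theorem exists_mem_smul_eq (hi : H.index = 2) (h2 : levelStab 2 ≤ H) (ha : swap [false] ∉ H)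
    {w w' : List Bool} (hw : w.length = w'.length) : ∃ h ∈ H, h • w = w' := by
  obtain ⟨g, hg⟩ := exists_smul_eq hw
  by_cases hgH : g ∈ H
  · exact ⟨g, hgH, hg⟩
  -- The word `w` lies below at most one vertex of level one, so a swap at the other fixes it and
  -- corrects the coset.
  · obtain ⟨t, ht, htw⟩ : ∃ t, t ∉ H ∧ t • w = w := by
      by_cases h : [false] <:+ w
      · exact ⟨swap [true], by rwa [swap_true_mem_iff hi h2],
          swap_mem_rist _ _ (not_suffix_of_ne (v := [false]) rfl (by simp) h)⟩
      · exact ⟨swap [false], ha, swap_mem_rist _ _ h⟩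
    exact ⟨g * t, (Subgroup.mul_mem_iff_of_index_two hi).2 (by tauto), by rw [mul_smul, htw, hg]⟩

/-- A subgroup of index two with the swaps at level one fixes level one. -/
theorem smul_singleton (hi : H.index = 2) (h2 : levelStab 2 ≤ H) (ha : swap [false] ∈ H)
    {h : Omega} (hh : h ∈ H) (c : Bool) : h • [c] = [c] := by
  obtain ⟨r, p, q, hr, hp, hq, hg⟩ := exists_swaps_mul_mem_levelStab h
  have hs := swap_nil_notMem hi h2 ha
  have hb := (swap_true_mem_iff hi h2).2 ha
  have hp1 : p ∈ H ∧ p ∈ rist [false] := by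
    rcases hp with rfl | rfl
    · exact ⟨one_mem _, one_mem _⟩
    · exact ⟨ha, swap_mem_rist _⟩
  have hq1 : q ∈ H ∧ q ∈ rist [true] := by
    rcases hq with rfl | rfl
    · exact ⟨one_mem _, one_mem _⟩
    · exact ⟨hb, swap_mem_rist _⟩
  have hrH := h2 hg
  rw [Subgroup.mul_mem_cancel_left _ hq1.1, Subgroup.mul_mem_cancel_left _ hp1.1,
    Subgroup.mul_mem_cancel_right _ hh] at hrH
  rcases hr with rfl | rfl
  · have := hg [c] (by simp)
    rwa [mul_smul, mul_smul, one_mul, smul_eq_of_mem_rist hp1.2 (by simp),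
      smul_eq_of_mem_rist hq1.2 (by simp)] at this
  · exact absurd hrH hs

/-- In a subgroup of index two that contains the swap at the root but not the swaps at level one,
squares act trivially on level two. -/
theorem smul_smul_eq_of_swap_nil_mem (hi : H.index = 2) (h2 : levelStab 2 ≤ H)
    (hs : swap [] ∈ H) (ha : swap [false] ∉ H) {h : Omega} (hh : h ∈ H) {v : List Bool}
    (hv : v.length = 2) : h • h • v = v := by
  obtain ⟨r, p, q, hr, hp, hq, hg⟩ := exists_swaps_mul_mem_levelStab h
  have hb := (swap_true_mem_iff hi h2).not.2 ha
  have key : ∀ u : List Bool, u.length = 2 → h • u = r⁻¹ • p⁻¹ • q⁻¹ • u := by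
    intro u hu
    have := hg u hu.le
    rw [mul_smul, mul_smul, mul_smul] at this
    rw [eq_inv_smul_iff, eq_inv_smul_iff, eq_inv_smul_iff, this]
  have hpq := h2 hg
  have hrH : r ∈ H := by
    rcases hr with rfl | rfl
    · exact one_mem _
    · exact hs
  -- As `r` and `h` are in `H`, parity forces `p` and `q` to be both trivial or both swaps.
  simp only [Subgroup.mul_mem_iff_of_index_two hi, hrH, hh, iff_true] at hpq
  rw [key (h • v) (by simp [hv]), key v hv]
  obtain ⟨c, d, rfl⟩ := List.length_eq_two.1 hv
  rcases hr with rfl | rfl <;> rcases hp with rfl | rfl <;> rcases hq with rfl | rfl <;>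
    first
    | (exfalso; simp [ha, hb, one_mem] at hpq; done)
    | (simp only [inv_one, one_smul, inv_eq_of_mul_eq_one_left (swap_mul_self _)]
       try (cases c <;> cases d <;> rfl))

/-! ### Telling the three subgroups apart -/

/-- `H₁` fixes both vertices of level one, so `H₂` preserves each of the two parts of a deep level.
Without `swap [false]`, however, `H₂` would be transitive on that level. -/
theorem swap_false_mem_of_mulEquiv {φ : H₁ ≃* H₂} (hφ : Continuous φ.symm)
    (ho₁ : IsOpen (H₁ : Set Omega)) (ho₂ : IsOpen (H₂ : Set Omega)) (hi₁ : H₁.index = 2)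
    (hi₂ : H₂.index = 2) (h₁ : levelStab 2 ≤ H₁) (h₂ : levelStab 2 ≤ H₂)
    (ha : swap [false] ∈ H₁) : swap [false] ∈ H₂ := by
  by_contra ha₂
  obtain ⟨k, hk⟩ := exists_forall_existsUnique_meets hφ ho₁ ho₂ 1
  obtain ⟨w, hw, hm⟩ := exists_meets (φ := φ) ⟨2, h₁⟩ [false] k
  obtain ⟨w', hw', hm'⟩ := exists_meets (φ := φ) ⟨2, h₁⟩ [true] k
  obtain ⟨h, hh, hhw⟩ := exists_mem_smul_eq hi₂ h₂ ha₂ (hw.trans hw'.symm)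
  obtain ⟨y, hy⟩ := φ.surjective ⟨h, hh⟩
  have h3 := hm.smul y
  rw [hy, smul_singleton hi₁ h₁ ha y.2, hhw] at h3
  simpa using (hk w' hw'.ge).unique ⟨rfl, h3⟩ ⟨rfl, hm'⟩

/-- Squares in `H₁` fix level two, so squares in `H₂` preserve each of the four parts of a deep
level. If `H₂` were the cyclic case, squares would carry a vertex below `[c, d]` to any vertex below
`[!c, d]` on its level, leaving at most two parts. -/
theorem swap_nil_mem_of_mulEquiv {φ : H₁ ≃* H₂} (hφ : Continuous φ.symm)
    (ho₁ : IsOpen (H₁ : Set Omega)) (ho₂ : IsOpen (H₂ : Set Omega)) (hi₁ : H₁.index = 2)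
    (hi₂ : H₂.index = 2) (h₁ : levelStab 2 ≤ H₁) (h₂ : levelStab 2 ≤ H₂)
    (ha₁ : swap [false] ∉ H₁) (ha₂ : swap [false] ∉ H₂) (hs : swap [] ∈ H₁) :
    swap [] ∈ H₂ := by
  by_contra hs₂
  obtain ⟨k, hk⟩ := exists_forall_existsUnique_meets hφ ho₁ ho₂ 2
  -- some element of `H₂` acts on level two as a cycle of length four
  have hx : swap [] * swap [false] ∈ H₂ :=
    (Subgroup.mul_mem_iff_of_index_two hi₂).2 (by tauto)
  have hx2 : ∀ c d : Bool, (swap [] * swap [false]) • (swap [] * swap [false]) • [c, d] = [!c, d] := by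
    intro c d
    cases c <;> cases d <;> rfl
  have hx1 : ∀ c d : Bool, (swap [] * swap [false]) • [c, d] ≠ [c, d] := by
    intro c d h
    have := hx2 c d
    rw [h, h] at this
    simp at this
  generalize swap [] * swap [false] = x at hx hx1 hx2
  have hcross : ∀ (c d : Bool) (v w w' : List Bool), v.length = 2 → w.length = w'.length →
      [c, d] <:+ w → [!c, d] <:+ w' → Meets φ v w → Meets φ v w' := by
    intro c d v w w' hv hw hcw hcw' hm
    have h1 : [!c, d] <:+ x • x • w := by
      rw [← hx2]
      exact suffix_smul _ (suffix_smul _ hcw)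
    -- In `(r * x) * (r * x)` the inner `r` is conjugated by `x` away from the subtree below `[!c,
    -- d]`, so only the outer one acts on `x • x • w`.
    obtain ⟨r, hr, hrw⟩ := exists_mem_rist_smul_eq (by simp [hw]) h1 hcw'
    have hrx : (r * x) • (r * x) • w = w' := by
      have h2 : (x * r * x⁻¹) • x • x • w = x • x • w :=
        conj_mem_rist x hr _ (not_suffix_of_ne (by simp) (hx1 _ _).symm h1)
      rw [mul_smul, mul_smul, inv_smul_smul] at h2
      rw [mul_smul, mul_smul, h2, hrw]
    obtain ⟨y, hy⟩ := φ.surjective ⟨r * x, mul_mem (h₂ (rist_le_levelStab le_rfl hr)) hx⟩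
    have h3 := (hm.smul y).smul y
    rwa [smul_smul_eq_of_swap_nil_mem hi₁ h₁ hs ha₁ y.2 hv, hy, hrx] at h3
  have hsame : ∀ (d : Bool) (v v' w w' : List Bool), v.length = 2 → v'.length = 2 →
      w.length = max k 2 → w'.length = max k 2 → [d] <:+ w → [d] <:+ w' →
      Meets φ v w → Meets φ v' w' → v = v' := by
    intro d v v' w w' hv hv' hw hw' hdw hdw' hm hm'
    have hsplit : ∀ u : List Bool, u.length = max k 2 → [d] <:+ u → ∃ c, [c, d] <:+ u := by
      intro u hu hdu
      obtain ⟨z, hz, hzu⟩ := exists_suffix_length_eq (n := 2) (w := u) (by omega)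
      obtain ⟨c, e, rfl⟩ := List.length_eq_two.1 hz
      have : [e] = [d] := ((List.suffix_of_suffix_length_le ((List.suffix_cons c [e]).trans hzu)
        hdu le_rfl).eq_of_length rfl)
      obtain rfl : e = d := by simpa using this
      exact ⟨c, hzu⟩
    obtain ⟨c, hc⟩ := hsplit w hw hdw
    obtain ⟨c', hc'⟩ := hsplit w' hw' hdw'
    refine (hk w' (by omega)).unique ⟨hv, ?_⟩ ⟨hv', hm'⟩
    by_cases hcc : c' = !c
    · subst hcc
      exact hcross c d v w w' hv (hw.trans hw'.symm) hc hc' hm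
    · obtain rfl : c' = c := by simpa using hcc
      -- Within one subtree, cross to the sibling subtree and back.
      obtain ⟨u, hu, hcu⟩ := exists_extension_length_eq (v := [!c', d]) (n := max k 2) (by simp)
      refine hcross (!c') d v u w' hv (hu.trans hw'.symm) hcu (by simpa using hc') ?_
      exact hcross c' d v w u hv (hw.trans hu.symm) hc hcu hm
  choose c hck hc using fun v => exists_meets (φ := φ) ⟨2, h₁⟩ v (max k 2)
  have hlast : ∀ v, ∃ d, [d] <:+ c v := by
    intro v
    obtain ⟨z, hz, hzv⟩ := exists_suffix_length_eq (n := 1) (w := c v) (by rw [hck]; omega)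
    obtain ⟨d, rfl⟩ := List.length_eq_one_iff.1 hz
    exact ⟨d, hzv⟩
  choose d hd using hlast
  have hinj : ∀ v v' : List Bool, v.length = 2 → v'.length = 2 → v ≠ v' → d v ≠ d v' :=
    fun v v' hv hv' hne h =>
      hne (hsame (d v) v v' _ _ hv hv' (hck v) (hck v') (hd v) (h ▸ hd v') (hc v) (hc v'))
  -- The part depends only on the level-one ancestor, a Boolean, so three vertices of level two
  -- already give a contradiction.
  have e1 := hinj [false, false] [false, true] rfl rfl (by simp)
  have e2 := hinj [false, false] [true, false] rfl rfl (by simp)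
  have e3 := hinj [false, true] [true, false] rfl rfl (by simp)
  revert e1 e2 e3
  cases d [false, false] <;> cases d [false, true] <;> cases d [true, false] <;> simp

/-! ### Conclusion -/

theorem pairTransitive_of_index_eq_one (hi : H.index = 1) : PairTransitive H := by
  rw [Subgroup.index_eq_one.1 hi]
  exact fun _ _ g => ⟨g, Subgroup.mem_top g, rfl, rfl⟩

theorem eq_of_continuousMulEquiv (ho₁ : IsOpen (H₁ : Set Omega)) (ho₂ : IsOpen (H₂ : Set Omega))
    (hi₁ : H₁.index = 1 ∨ H₁.index = 2) (hi₂ : H₂.index = 1 ∨ H₂.index = 2) (φ : H₁ ≃ₜ* H₂) :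
    H₁ = H₂ := by
  have hφ : Continuous φ.toMulEquiv.symm := φ.continuous_invFun
  have hψ : Continuous φ.toMulEquiv.symm.symm := φ.continuous_toFun
  have n₁ := normal_of_index hi₁
  have n₂ := normal_of_index hi₂
  by_cases hQ₂ : PairTransitive H₂
  · exact eq_of_pairTransitive hφ ho₁ ho₂ hQ₂
  by_cases hQ₁ : PairTransitive H₁
  · exact (eq_of_pairTransitive hψ ho₂ ho₁ hQ₁).symm
  replace hi₁ := hi₁.resolve_left fun h => hQ₁ (pairTransitive_of_index_eq_one h)
  replace hi₂ := hi₂.resolve_left fun h => hQ₂ (pairTransitive_of_index_eq_one h)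
  have h₁ := levelStab_two_le_of_not_pairTransitive hi₁ hQ₁
  have h₂ := levelStab_two_le_of_not_pairTransitive hi₂ hQ₂
  have ha : swap [false] ∈ H₁ ↔ swap [false] ∈ H₂ :=
    ⟨swap_false_mem_of_mulEquiv hφ ho₁ ho₂ hi₁ hi₂ h₁ h₂,
      swap_false_mem_of_mulEquiv hψ ho₂ ho₁ hi₂ hi₁ h₂ h₁⟩
  refine eq_of_swap_mem_iff hi₁ hi₂ h₁ h₂ ?_ ha
  by_cases ha₁ : swap [false] ∈ H₁
  · exact iff_of_false (swap_nil_notMem hi₁ h₁ ha₁) (swap_nil_notMem hi₂ h₂ (ha.1 ha₁))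
  · have ha₂ := ha.not.1 ha₁
    exact ⟨swap_nil_mem_of_mulEquiv hφ ho₁ ho₂ hi₁ hi₂ h₁ h₂ ha₁ ha₂,
      swap_nil_mem_of_mulEquiv hψ ho₂ ho₁ hi₂ hi₁ h₂ h₁ ha₂ ha₁⟩

end Omega

theorem theoremC (H₁ H₂ : Subgroup Omega)
    (hH₁ : IsClosed (H₁ : Set Omega)) (hH₂ : IsClosed (H₂ : Set Omega))
    (hi₁ : H₁.index = 1 ∨ H₁.index = 2) (hi₂ : H₂.index = 1 ∨ H₂.index = 2) :
    Nonempty (H₁ ≃ₜ* H₂) ↔ H₁ = H₂ := by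
  constructor
  · rintro ⟨φ⟩
    exact Omega.eq_of_continuousMulEquiv (Omega.isOpen_of_isClosed_of_index hH₁ hi₁)
      (Omega.isOpen_of_isClosed_of_index hH₂ hi₂) hi₁ hi₂ φ
  · rintro rfl
    exact ⟨ContinuousMulEquiv.refl _⟩
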